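/- A feedforward ReLU network $N:\mathbb R^{n_0}\to\mathbb R^{n_L}$ is a composition of finitely many (at least one) layers $x\mapsto\sigma(Wx+b)$, where $\sigma$ is the componentwise ReLU $t\mapsto\max(t,0)$ in every hidden layer, and ReLU or the identity in the output layer. An H-polytope is an intersection of finitely many closed halfspaces $\{x: v^{T}x\le c\}$. Two sets are almost disjoint if their intersection has Lebesgue measure $0$. A splitting of the input space for $N$ consists of finitely many pairwise almost disjoint H-polytopes $P_1,\dots,P_{q_Y}$ with union $\mathbb R^{n_0}$ and affine maps $NN^j(x)=c^j+V^jx$ such that $N(x)=NN^j(x)$ for all $x\in P_j$. Theorem (exact cdf of a ReLU network with respect to a piecewise polynomial pdf). Let $N:\mathbb R^{n_0}\to\mathbb R^{n_L}$ be a feedforward ReLU network. Let $X$ be a random vector in $\mathbb R^{n_0}$ with probability density function $\phi\ge 0$ which vanishes outside a compact hyperrectangle $K=[a,b]\subset\mathbb R^{n_0}$ and is piecewise polynomial on $K$: $K=\bigcup_{i=1}^{q_\phi}k_i$ for pairwise almost disjoint (nondegenerate) $n_0$-dimensional simplices $k_i$, and there are polynomials $\phi_i$ with $\phi=\phi_i$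 on the interior of $k_i$. Then: 1. A splitting of the input space for $N$ exists. 2. For every splitting $(P_j,NN^j)_{j=1}^{q_Y}$ for $N$ and every $y\in\mathbb R^{n_L}$, put $$P^r_{j,i}=P_j\cap k_i\cap\{x: NN^j(x)\le y\},\qquad \{x:NN^j(x)\le y\}=\bigcap_{t=1}^{n_L}\{x:NN^j_t(x)\le y_t\}.$$ Then the cdf of $\widetilde Y=N(X)$ at $y$ (inequalities componentwise) is $$F_{\widetilde Y}(y)=\mathbb P[\widetilde Y\le y]=\sum_{i=1}^{q_\phi}\sum_{j=1}^{q_Y}\int_{P^r_{j,i}}\phi_i(x)\,dx .$$ 3. In 2, each $P^r_{j,i}$ is an H-polytope and has a triangulation, that is, $P^r_{j,i}=\bigcup_{s=1}^{S_{i,j}}T_{i,j,s}$ with finitely many nondegenerate simplices $T_{i,j,s}$ of the same dimension as $P^r_{j,i}$ (no simplices if $P^r_{j,i}$ is empty), which are pairwise almost disjoint and have pairwise disjoint relative interiors. For every choice of such triangulations, $$F_{\widetilde Y}(y)=\sum_{i=1}^{q_\phi}\sum_{j=1}^{q_Y}\sum_{s=1}^{S_{i,j}}\int_{T_{i,j,s}}\phi_i(x)\,dx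 .$$ -/

import Mathlib

open MeasureTheory ProbabilityTheory Matrix

/-- A feedforward ReLU network with input dimension `m` and output dimension `n`, given by its
weight matrices and bias vectors, listed from the input layer to the output layer.
All hidden layers carry the ReLU activation; the output layer carries either the ReLU activation
or the identity (a linear output layer). The numbers of layers (at least one) and the widths are
arbitrary. -/
inductive ReLUNetwork : ℕ → ℕ → Type
  | reluOutput {m n : ℕ} (W : Matrix (Fin n) (Fin m) ℝ) (b : Fin n → ℝ) : ReLUNetwork m n
  | linearOutput {m n : ℕ} (W : Matrix (Fin n) (Fin m) ℝ) (b : Fin n → ℝ) : ReLUNetwork m n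
  | hidden {m l n : ℕ} (W : Matrix (Fin l) (Fin m) ℝ) (b : Fin l → ℝ)
      (rest : ReLUNetwork l n) : ReLUNetwork m n

/-- The ReLU activation, applied componentwise. -/
noncomputable def relu {n : ℕ} (x : Fin n → ℝ) : Fin n → ℝ := fun i => max (x i) 0

/-- The function computed by a network: a layer maps `x` to `σ (W x + b)`. -/
noncomputable def ReLUNetwork.eval : {m n : ℕ} → ReLUNetwork m n → (Fin m → ℝ) → (Fin n → ℝ)
  | _, _, .reluOutput W b, x => relu (W *ᵥ x + b)
  | _, _, .linearOutput W b, x => W *ᵥ x + b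
  | _, _, .hidden W b rest, x => rest.eval (relu (W *ᵥ x + b))

/-- An H-polytope: the intersection of finitely many closed halfspaces `{x | vᵀ x ≤ c}`
(not necessarily bounded). -/
def IsHPolytope {n : ℕ} (A : Set (Fin n → ℝ)) : Prop :=
  ∃ (h : ℕ) (v : Fin h → Fin n → ℝ) (c : Fin h → ℝ), A = ⋂ i, {x | v i ⬝ᵥ x ≤ c i}

/-- The network splits the input space into the finitely many, pairwise almost disjoint polytopes
`P j`, and coincides on `P j` with the affine map `x ↦ c j + V j x`. -/
structure ReLUNetwork.IsSplitBy {n₀ nL : ℕ} (N : ReLUNetwork n₀ nL) {q : ℕ}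
    (P : Fin q → Set (Fin n₀ → ℝ)) (V : Fin q → Matrix (Fin nL) (Fin n₀) ℝ)
    (c : Fin q → Fin nL → ℝ) : Prop where
  polytope : ∀ j, IsHPolytope (P j)
  cover : ⋃ j, P j = Set.univ
  almost_disjoint : Pairwise fun j j' => volume (P j ∩ P j') = 0
  eval_eq : ∀ j, ∀ x ∈ P j, N.eval x = c j + V j *ᵥ x

/-- The function `φ` is supported on the compact hyperrectangle `[a, b]` and is a piecewise
polynomial there: `[a, b]` is the union of the pairwise almost disjoint full-dimensional simplices
`k i`, and `φ` agrees with the polynomial `p i` on the interior of `k i`. Nothing is required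
of the values of `φ` on the boundaries of the simplices. -/
structure IsPiecewisePolynomialOnBox {n : ℕ} (φ : (Fin n → ℝ) → ℝ) (a b : Fin n → ℝ) {q : ℕ}
    (k : Fin q → Affine.Simplex ℝ (Fin n → ℝ) n) (p : Fin q → MvPolynomial (Fin n) ℝ) :
    Prop where
  union : ⋃ i, (k i).closedInterior = Set.Icc a b
  almost_disjoint :
    Pairwise fun i i' => volume ((k i).closedInterior ∩ (k i').closedInterior) = 0
  eq_poly : ∀ i, ∀ x ∈ interior (k i).closedInterior, φ x = MvPolynomial.eval x (p i)
  support : ∀ x, x ∉ Set.Icc a b → φ x = 0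

/-- The real function `φ` is a probability density function of the random vector `X`,
with respect to Lebesgue measure. -/
structure IsPDFOf {Ω : Type*} [MeasurableSpace Ω] {n : ℕ} (φ : (Fin n → ℝ) → ℝ)
    (X : Ω → Fin n → ℝ) (μ : Measure Ω) : Prop where
  hasPDF : HasPDF X μ volume
  nonneg : ∀ x, 0 ≤ φ x
  pdf_eq : pdf X μ volume =ᵐ[volume] fun x => ENNReal.ofReal (φ x)

/-- The joint cdf `y ↦ μ[Y ≤ y]` of a random vector, with `≤` componentwise. -/
noncomputable def jointCDF {Ω : Type*} [MeasurableSpace Ω] {n : ℕ} (μ : Measure Ω)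
    (Y : Ω → Fin n → ℝ) (y : Fin n → ℝ) : ℝ :=
  μ.real {ω | Y ω ≤ y}

/-- The reduced polytope `P ∩ k ∩ {x | c + V x ≤ y}`. -/
def reducedPolytope {n m : ℕ} (P : Set (Fin n → ℝ)) (k : Affine.Simplex ℝ (Fin n → ℝ) n)
    (V : Matrix (Fin m) (Fin n) ℝ) (c y : Fin m → ℝ) : Set (Fin n → ℝ) :=
  P ∩ k.closedInterior ∩ {x | c + V *ᵥ x ≤ y}

/-- The dimension of (the affine hull of) a subset of `ℝⁿ`. -/
noncomputable def affineDim {n : ℕ} (A : Set (Fin n → ℝ)) : ℕ :=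
  Module.finrank ℝ (vectorSpan ℝ A)

/-- A finite family of nondegenerate simplices, of the same dimension as `A`, triangulates `A`:
their union is `A`, they are pairwise almost disjoint, and their relative interiors are pairwise
disjoint (for full-dimensional simplices the last two conditions say the same; the last one gives
the notion its content when `A` is lower-dimensional, so Lebesgue-null). -/
structure IsTriangulation {n : ℕ} (A : Set (Fin n → ℝ)) {S : ℕ}
    (T : Fin S → Affine.Simplex ℝ (Fin n → ℝ) (affineDim A)) : Prop where
  union : ⋃ s, (T s).closedInterior = A
  almost_disjoint :
    Pairwise fun s s' => volume ((T s).closedInterior ∩ (T s').closedInterior) = 0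
  disjoint_interior : Pairwise fun s s' =>
    Disjoint (intrinsicInterior ℝ (T s).closedInterior)
      (intrinsicInterior ℝ (T s').closedInterior)

/-! ### H-polytopes as intersections of nonpositivity sets of affine functionals -/

/-! Once the signs of all preactivations are fixed, a ReLU network is affine. Finitely many affine
functionals decide these signs, so their sign cells split the input space, and distinct cells meet
inside a hyperplane (`ReLUNetwork.exists_isSplitBy`). For any splitting, the event `N.eval x ≤ y`
inside the box is the union of the reduced polytopes, which overlap in null sets and on which the
density is a.e. polynomial. Additivity of the integral gives the cdf
(`jointCDF_eq_sum_reducedPolytope`), and again the sum over a triangulation. To triangulate a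
bounded polytope, pass to coordinates on its affine hull, where it has nonempty interior. Enclose it
in a large simplex and bisect that simplex along edges until no defining functional changes sign on
a piece. The pieces inside the polytope then fill it (`IsHPolytope.exists_isDissection`). -/

theorem AffineMap.exists_eq_dotProduct_add {n : ℕ} (f : (Fin n → ℝ) →ᵃ[ℝ] ℝ) :
    ∃ v : Fin n → ℝ, ∀ x, f x = v ⬝ᵥ x + f 0 := by
  refine ⟨fun i => f.linear (Pi.single i 1), fun x => ?_⟩
  have h := f.linear.pi_apply_eq_sum_univ x
  have h' : f x = f.linear x + f 0 := by
    simpa using f.map_vadd 0 x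
  rw [h', h]
  simp only [dotProduct, smul_eq_mul, mul_comm]
  congr 1
  refine Finset.sum_congr rfl fun i _ => ?_
  congr 2
  ext j
  simp [Pi.single_apply, eq_comm]

theorem IsHPolytope.of_affine {n : ℕ} {ι : Type*} [Finite ι]
    (f : ι → (Fin n → ℝ) →ᵃ[ℝ] ℝ) : IsHPolytope (⋂ i, {x | f i x ≤ 0}) := by
  choose v hv using fun i => (f i).exists_eq_dotProduct_add
  obtain ⟨h, ⟨e⟩⟩ := Finite.exists_equiv_fin ι
  refine ⟨h, fun i => v (e.symm i), fun i => -(f (e.symm i) 0), ?_⟩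
  ext x
  simp only [Set.mem_iInter, Set.mem_ofPred_eq]
  rw [← e.symm.forall_congr_right]
  refine forall_congr' fun i => ?_
  rw [hv]
  constructor <;> intro h <;> linarith

theorem IsHPolytope.exists_affine {n : ℕ} {A : Set (Fin n → ℝ)} (hA : IsHPolytope A) :
    ∃ (h : ℕ) (f : Fin h → (Fin n → ℝ) →ᵃ[ℝ] ℝ), A = ⋂ i, {x | f i x ≤ 0} := by
  obtain ⟨h, v, c, rfl⟩ := hA
  refine ⟨h, fun i => (dotProductBilin ℝ ℝ (v i)).toAffineMap - AffineMap.const ℝ _ (c i), ?_⟩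
  simp [dotProductBilin]

theorem IsHPolytope.inter {n : ℕ} {A B : Set (Fin n → ℝ)} (hA : IsHPolytope A)
    (hB : IsHPolytope B) : IsHPolytope (A ∩ B) := by
  obtain ⟨h, f, rfl⟩ := hA.exists_affine
  obtain ⟨h', f', rfl⟩ := hB.exists_affine
  have := IsHPolytope.of_affine (Sum.elim f f')
  rwa [Set.iInter_sum] at this

theorem IsHPolytope.isClosed {n : ℕ} {A : Set (Fin n → ℝ)} (hA : IsHPolytope A) :
    IsClosed A := by
  obtain ⟨h, f, rfl⟩ := hA.exists_affine
  exact isClosed_iInter fun i =>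
    isClosed_le (f i).continuous_of_finiteDimensional continuous_const

theorem IsHPolytope.convex {n : ℕ} {A : Set (Fin n → ℝ)} (hA : IsHPolytope A) :
    Convex ℝ A := by
  obtain ⟨h, f, rfl⟩ := hA.exists_affine
  exact convex_iInter fun i => (convex_Iic (0 : ℝ)).affine_preimage (f i)

theorem isHPolytope_affine_le {n m : ℕ} (V : Matrix (Fin m) (Fin n) ℝ) (c y : Fin m → ℝ) :
    IsHPolytope {x | c + V *ᵥ x ≤ y} := by
  refine ⟨m, fun t => V t, fun t => y t - c t, ?_⟩
  ext x
  simp only [Pi.le_def, Set.mem_ofPred_eq, Set.mem_iInter, Pi.add_apply, mulVec]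
  exact forall_congr' fun t => ⟨fun h => by linarith, fun h => by linarith⟩

/-! ### Full-dimensional simplices -/

/-- The vertices of a full-dimensional simplex as an affine basis. -/
noncomputable def Affine.Simplex.affineBasis {n : ℕ} (T : Affine.Simplex ℝ (Fin n → ℝ) n) :
    AffineBasis (Fin (n + 1)) ℝ (Fin n → ℝ) :=
  ⟨T.points, T.independent,
    T.independent.affineSpan_eq_top_iff_card_eq_finrank_add_one.2 (by simp)⟩

theorem Affine.Simplex.closedInterior_eq_nonneg_coord {n : ℕ}
    (T : Affine.Simplex ℝ (Fin n → ℝ) n) :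
    T.closedInterior = {x | ∀ i, 0 ≤ T.affineBasis.coord i x} := by
  rw [← T.affineBasis.convexHull_eq_nonneg_coord]
  exact T.convexHull_eq_closedInterior.symm

theorem Affine.Simplex.isHPolytope_closedInterior {n : ℕ}
    (T : Affine.Simplex ℝ (Fin n → ℝ) n) : IsHPolytope T.closedInterior := by
  have := IsHPolytope.of_affine fun i => -T.affineBasis.coord i
  rw [T.closedInterior_eq_nonneg_coord]
  convert this using 1
  ext x
  simp

theorem Affine.Simplex.convex_closedInterior {n d : ℕ} (T : Affine.Simplex ℝ (Fin n → ℝ) d) :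
    Convex ℝ T.closedInterior := by
  rw [← T.convexHull_eq_closedInterior]
  exact convex_convexHull _ _

theorem Affine.Simplex.affineSpan_closedInterior {n d : ℕ}
    (T : Affine.Simplex ℝ (Fin n → ℝ) d) :
    affineSpan ℝ T.closedInterior = affineSpan ℝ (Set.range T.points) := by
  rw [← T.convexHull_eq_closedInterior, affineSpan_convexHull]

theorem isHPolytope_reducedPolytope {n m : ℕ} {P : Set (Fin n → ℝ)} (hP : IsHPolytope P)
    (k : Affine.Simplex ℝ (Fin n → ℝ) n) (V : Matrix (Fin m) (Fin n) ℝ) (c y : Fin m → ℝ) :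
    IsHPolytope (reducedPolytope P k V c y) :=
  (hP.inter k.isHPolytope_closedInterior).inter (isHPolytope_affine_le V c y)

/-! ### The zero set of a nonzero affine functional -/

/-- The zero set is a proper affine subspace. Almost-disjointness of sign cells and of the two
halves of a bisected simplex comes from here. -/
theorem volume_affine_zero {n : ℕ} (f : (Fin n → ℝ) →ᵃ[ℝ] ℝ) (hf : f ≠ 0) :
    volume {x | f x = 0} = 0 := by
  have h : {x | f x = 0} = ((⊥ : Submodule ℝ ℝ).toAffineSubspace.comap f : Set (Fin n → ℝ)) := by
    ext x
    simp
  rw [h]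
  refine Measure.addHaar_affineSubspace _ _ fun htop => hf ?_
  ext x
  have : x ∈ (⊥ : Submodule ℝ ℝ).toAffineSubspace.comap f := htop ▸ AffineSubspace.mem_top ..
  simpa using this

/-! ### Splitting the input space -/

/-- The affine map that sets the coordinates selected by `τ` to zero. -/
noncomputable def coordMask {n : ℕ} (τ : Fin n → Bool) : (Fin n → ℝ) →ᵃ[ℝ] (Fin n → ℝ) :=
  (LinearMap.pi fun i => if τ i then 0 else LinearMap.proj i).toAffineMap

theorem relu_eq_coordMask {n : ℕ} (τ : Fin n → Bool) (x : Fin n → ℝ)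
    (h : ∀ i, if τ i then x i ≤ 0 else 0 ≤ x i) : relu x = coordMask τ x := by
  ext i
  have := h i
  by_cases hi : τ i <;> simp_all [relu, coordMask]

/-- The affine map of a layer before activation. -/
noncomputable def preactivation {m n : ℕ} (W : Matrix (Fin n) (Fin m) ℝ) (b : Fin n → ℝ) :
    (Fin m → ℝ) →ᵃ[ℝ] (Fin n → ℝ) :=
  W.mulVecLin.toAffineMap + AffineMap.const ℝ _ b

theorem preactivation_apply {m n : ℕ} (W : Matrix (Fin n) (Fin m) ℝ) (b : Fin n → ℝ)
    (x : Fin m → ℝ) : preactivation W b x = W *ᵥ x + b := by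
  simp [preactivation]

/-- The `i`-th coordinate of a layer before activation. -/
noncomputable def preactivationCoord {m n : ℕ} (W : Matrix (Fin n) (Fin m) ℝ) (b : Fin n → ℝ)
    (i : Fin n) : (Fin m → ℝ) →ᵃ[ℝ] ℝ :=
  (LinearMap.proj i : (Fin n → ℝ) →ₗ[ℝ] ℝ).toAffineMap.comp (preactivation W b)

theorem preactivationCoord_apply {m n : ℕ} (W : Matrix (Fin n) (Fin m) ℝ) (b : Fin n → ℝ)
    (i : Fin n) (x : Fin m → ℝ) : preactivationCoord W b i x = (W *ᵥ x + b) i := by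
  simp [preactivationCoord, preactivation_apply]

/-- The function `F` is affine on each cell cut out by a choice of signs for the functionals
in `S`. -/
def IsAffineOnCells {m n : ℕ} (F : (Fin m → ℝ) → Fin n → ℝ)
    (S : Finset ((Fin m → ℝ) →ᵃ[ℝ] ℝ)) : Prop :=
  ∀ σ : ((Fin m → ℝ) →ᵃ[ℝ] ℝ) → Bool, ∃ g : (Fin m → ℝ) →ᵃ[ℝ] (Fin n → ℝ),
    ∀ x, (∀ f ∈ S, if σ f then f x ≤ 0 else 0 ≤ f x) → F x = g x

open Classical in
-- Induction on layers. The signs of the first preactivations turn ReLU into a fixed mask, through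
-- which the functionals of the remaining network pull back. The mask depends on the cell, so the
-- pullbacks through all masks are collected.
theorem ReLUNetwork.exists_isAffineOnCells {m n : ℕ} (N : ReLUNetwork m n) :
    ∃ S, IsAffineOnCells N.eval S := by
  induction N with
  | reluOutput W b =>
    refine ⟨Finset.univ.image (preactivationCoord W b), fun σ =>
      ⟨(coordMask fun i => σ (preactivationCoord W b i)).comp (preactivation W b),
        fun x hx => ?_⟩⟩
    simp only [ReLUNetwork.eval, AffineMap.comp_apply, preactivation_apply]
    refine relu_eq_coordMask _ _ fun i => ?_
    have h := hx _ (Finset.mem_image_of_mem _ (Finset.mem_univ i))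
    rwa [preactivationCoord_apply] at h
  | linearOutput W b =>
    exact ⟨∅, fun σ => ⟨preactivation W b, fun x _ => by
      simp [ReLUNetwork.eval, preactivation_apply]⟩⟩
  | @hidden m l n W b rest ih =>
    obtain ⟨S, hS⟩ := ih
    refine ⟨Finset.univ.image (preactivationCoord W b) ∪
      Finset.univ.biUnion fun τ : Fin l → Bool =>
        S.image fun f => f.comp ((coordMask τ).comp (preactivation W b)), fun σ => ?_⟩
    set τ : Fin l → Bool := fun i => σ (preactivationCoord W b i) with hτ
    obtain ⟨g, hg⟩ := hS fun f => σ (f.comp ((coordMask τ).comp (preactivation W b)))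
    refine ⟨g.comp ((coordMask τ).comp (preactivation W b)), fun x hx => ?_⟩
    have h1 : relu (W *ᵥ x + b) = coordMask τ (preactivation W b x) := by
      rw [preactivation_apply]
      refine relu_eq_coordMask _ _ fun i => ?_
      have h := hx _ (Finset.mem_union_left _ (Finset.mem_image_of_mem _ (Finset.mem_univ i)))
      rwa [preactivationCoord_apply] at h
    simp only [ReLUNetwork.eval, AffineMap.comp_apply]
    rw [h1]
    refine hg _ fun f hf => ?_
    have := hx _ (Finset.mem_union_right _ (Finset.mem_biUnion.2
      ⟨τ, Finset.mem_univ _, Finset.mem_image_of_mem _ hf⟩))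
    simpa using this

open Classical in
theorem ReLUNetwork.exists_isSplitBy {m n : ℕ} (N : ReLUNetwork m n) :
    ∃ (q : ℕ) (P : Fin q → Set (Fin m → ℝ)) (V : Fin q → Matrix (Fin n) (Fin m) ℝ)
      (c : Fin q → Fin n → ℝ), N.IsSplitBy P V c := by
  obtain ⟨S, hS⟩ := N.exists_isAffineOnCells
  -- The zero functional must go: cells differing only in its sign would coincide, and its zero set
  -- is not null. `ext` may give it either sign, since both conditions hold.
  let S' := {f // f ∈ S.erase 0}
  let ext : (S' → Bool) → ((Fin m → ℝ) →ᵃ[ℝ] ℝ) → Bool :=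
    fun σ f => if h : f ∈ S.erase 0 then σ ⟨f, h⟩ else true
  choose g hg using fun σ => hS (ext σ)
  obtain ⟨q, ⟨e⟩⟩ := Finite.exists_equiv_fin (S' → Bool)
  let P : (S' → Bool) → Set (Fin m → ℝ) := fun σ =>
    ⋂ f : S', {x | (if σ f then f.1 else -f.1) x ≤ 0}
  have hP : ∀ σ x, x ∈ P σ ↔ ∀ f : S', if σ f then f.1 x ≤ 0 else 0 ≤ f.1 x := by
    intro σ x
    simp only [P, Set.mem_iInter, Set.mem_ofPred_eq]
    refine forall_congr' fun f => ?_
    by_cases h : σ f <;> simp [h]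
  refine ⟨q, fun j => P (e.symm j), fun j => LinearMap.toMatrix' (g (e.symm j)).linear,
    fun j => g (e.symm j) 0, ⟨fun j => IsHPolytope.of_affine _, ?_, ?_, ?_⟩⟩
  · refine Set.eq_univ_of_forall fun x => Set.mem_iUnion.2
      ⟨e fun f => decide (f.1 x ≤ 0), ?_⟩
    rw [Equiv.symm_apply_apply, hP]
    intro f
    by_cases h : f.1 x ≤ 0
    · simp [h]
    · simp [h, (not_le.1 h).le]
  · intro j j' hjj'
    have hne : e.symm j ≠ e.symm j' := fun h => hjj' (e.symm.injective h)
    obtain ⟨f, hf⟩ := Function.ne_iff.1 hne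
    refine measure_mono_null ?_ (volume_affine_zero f.1 (Finset.ne_of_mem_erase f.2))
    rintro x ⟨hx, hx'⟩
    have h1 := (hP _ _).1 hx f
    have h2 := (hP _ _).1 hx' f
    show f.1 x = 0
    cases h : e.symm j f <;> cases h' : e.symm j' f <;> simp_all <;> linarith
  · intro j x hx
    have h := hg (e.symm j) x fun f hf => ?_
    · rw [h, LinearMap.toMatrix'_mulVec, add_comm]
      simpa using (g (e.symm j)).map_vadd 0 x
    · by_cases h0 : f = 0
      · subst h0; simp
      · have hf' : f ∈ S.erase 0 := Finset.mem_erase.2 ⟨h0, hf⟩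
        simpa [ext, h0, hf] using (hP _ _).1 hx ⟨f, hf'⟩

/-! ### Integrals over almost disjoint unions -/

theorem ReLUNetwork.IsSplitBy.setOf_eval_le {m n q : ℕ} {N : ReLUNetwork m n}
    {P : Fin q → Set (Fin m → ℝ)} {V : Fin q → Matrix (Fin n) (Fin m) ℝ}
    {c : Fin q → Fin n → ℝ} (h : N.IsSplitBy P V c) (y : Fin n → ℝ) :
    {x | N.eval x ≤ y} = ⋃ j, P j ∩ {x | c j + V j *ᵥ x ≤ y} := by
  ext x
  simp only [Set.mem_iUnion, Set.mem_inter_iff, Set.mem_ofPred_eq]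
  constructor
  · intro hx
    obtain ⟨j, hj⟩ := Set.mem_iUnion.1 (h.cover ▸ Set.mem_univ x)
    exact ⟨j, hj, h.eval_eq j x hj ▸ hx⟩
  · rintro ⟨j, hj, hx⟩
    exact (h.eval_eq j x hj).symm ▸ hx

theorem ReLUNetwork.IsSplitBy.measurableSet_eval_le {m n q : ℕ} {N : ReLUNetwork m n}
    {P : Fin q → Set (Fin m → ℝ)} {V : Fin q → Matrix (Fin n) (Fin m) ℝ}
    {c : Fin q → Fin n → ℝ} (h : N.IsSplitBy P V c) (y : Fin n → ℝ) :
    MeasurableSet {x | N.eval x ≤ y} := by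
  rw [h.setOf_eval_le]
  exact MeasurableSet.iUnion fun j =>
    ((h.polytope j).inter (isHPolytope_affine_le _ _ _)).isClosed.measurableSet

theorem MvPolynomial.integrableOn_eval {n : ℕ} (p : MvPolynomial (Fin n) ℝ)
    {s K : Set (Fin n → ℝ)} (hK : IsCompact K) (hs : s ⊆ K) :
    IntegrableOn (fun x => MvPolynomial.eval x p) s := by
  have hc : Continuous fun x => MvPolynomial.eval x p := MvPolynomial.continuous_eval p
  exact (hc.continuousOn.integrableOn_compact hK).mono_set hs

/-- Measurability of `φ` is not assumed. It is inherited from the density, because `φ ≥ 0` is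
recovered from `ENNReal.ofReal (φ x)`. -/
theorem IsPDFOf.aemeasurable {Ω : Type*} [MeasurableSpace Ω] {n : ℕ} {φ : (Fin n → ℝ) → ℝ}
    {X : Ω → Fin n → ℝ} {μ : Measure Ω} (h : IsPDFOf φ X μ) : AEMeasurable φ := by
  have h1 : AEMeasurable fun x => ENNReal.ofReal (φ x) :=
    (measurable_pdf X μ volume).aemeasurable.congr h.pdf_eq
  simpa [ENNReal.toReal_ofReal (h.nonneg _)] using h1.ennreal_toReal

theorem IsPDFOf.measureReal_preimage {Ω : Type*} [MeasurableSpace Ω] {n : ℕ}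
    {φ : (Fin n → ℝ) → ℝ} {X : Ω → Fin n → ℝ} {μ : Measure Ω} (h : IsPDFOf φ X μ)
    {M : Set (Fin n → ℝ)} (hM : MeasurableSet M) : μ.real (X ⁻¹' M) = ∫ x in M, φ x := by
  have := h.hasPDF
  rw [integral_eq_lintegral_of_nonneg_ae (Filter.Eventually.of_forall h.nonneg)
    h.aemeasurable.aestronglyMeasurable.restrict, Measure.real,
    ← Measure.map_apply_of_aemeasurable (HasPDF.aemeasurable X μ volume) hM,
    map_eq_setLIntegral_pdf X μ volume hM]
  congr 1
  exact lintegral_congr_ae (ae_restrict_of_ae h.pdf_eq)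

/-- The values of `φ` on simplex boundaries are arbitrary, but the frontier of a convex set is null.
-/
theorem IsPiecewisePolynomialOnBox.ae_eq {n q : ℕ} {φ : (Fin n → ℝ) → ℝ} {a b : Fin n → ℝ}
    {k : Fin q → Affine.Simplex ℝ (Fin n → ℝ) n} {p : Fin q → MvPolynomial (Fin n) ℝ}
    (h : IsPiecewisePolynomialOnBox φ a b k p) (i : Fin q) {s : Set (Fin n → ℝ)}
    (hs : s ⊆ (k i).closedInterior) :
    (fun x => MvPolynomial.eval x (p i)) =ᵐ[volume.restrict s] φ := by
  refine ae_restrict_of_ae_restrict_of_subset hs ?_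
  have hf := (k i).convex_closedInterior.addHaar_frontier volume
  refine (ae_restrict_iff' (k i).isClosed_closedInterior.measurableSet).2 ?_
  filter_upwards [measure_eq_zero_iff_ae_notMem.1 hf] with x hx hxk
  refine (h.eq_poly i x ?_).symm
  by_contra hni
  exact hx ⟨subset_closure hxk, hni⟩

theorem jointCDF_eq_sum_reducedPolytope {n₀ nL : ℕ} {N : ReLUNetwork n₀ nL}
    {Ω : Type*} [MeasurableSpace Ω] {μ : Measure Ω}
    {X : Ω → Fin n₀ → ℝ} {φ : (Fin n₀ → ℝ) → ℝ} (hX : IsPDFOf φ X μ)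
    {a b : Fin n₀ → ℝ} {qφ : ℕ} {k : Fin qφ → Affine.Simplex ℝ (Fin n₀ → ℝ) n₀}
    {p : Fin qφ → MvPolynomial (Fin n₀) ℝ} (hφ : IsPiecewisePolynomialOnBox φ a b k p)
    {qY : ℕ} {P : Fin qY → Set (Fin n₀ → ℝ)} {V : Fin qY → Matrix (Fin nL) (Fin n₀) ℝ}
    {c : Fin qY → Fin nL → ℝ} (hP : N.IsSplitBy P V c) (y : Fin nL → ℝ) :
    jointCDF μ (fun ω => N.eval (X ω)) y =
      ∑ i, ∑ j, ∫ x in reducedPolytope (P j) (k i) (V j) (c j) y,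
        MvPolynomial.eval x (p i) := by
  set R : Fin qφ × Fin qY → Set (Fin n₀ → ℝ) :=
    fun z => reducedPolytope (P z.2) (k z.1) (V z.2) (c z.2) y with hR
  have hRk : ∀ z, R z ⊆ (k z.1).closedInterior := fun z x hx => hx.1.2
  have hRm : ∀ z, MeasurableSet (R z) := fun z =>
    (isHPolytope_reducedPolytope (hP.polytope _) _ _ _ _).isClosed.measurableSet
  have hM := hP.measurableSet_eval_le y
  have hMR : {x | N.eval x ≤ y} ∩ Set.Icc a b = ⋃ z, R z := by
    rw [hP.setOf_eval_le, ← hφ.union]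
    ext x
    simp only [hR, reducedPolytope, Set.mem_inter_iff, Set.mem_iUnion, Prod.exists]
    constructor
    · rintro ⟨⟨j, hj, hy⟩, i, hi⟩
      exact ⟨i, j, ⟨hj, hi⟩, hy⟩
    · rintro ⟨i, j, ⟨hj, hi⟩, hy⟩
      exact ⟨⟨j, hj, hy⟩, i, hi⟩
  have hdisj : Pairwise (Function.onFun (AEDisjoint volume) R) := by
    rintro ⟨i, j⟩ ⟨i', j'⟩ hne
    -- For equal `i` the overlap lies in two distinct cells of the splitting, otherwise in two
    -- distinct simplices of the box.
    by_cases hi : i = i'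
    · have hj : j ≠ j' := fun hj => hne (by rw [hi, hj])
      exact measure_mono_null (Set.inter_subset_inter (fun x hx => hx.1.1) fun x hx => hx.1.1)
        (hP.almost_disjoint hj)
    · exact measure_mono_null (Set.inter_subset_inter (fun x hx => hx.1.2) fun x hx => hx.1.2)
        (hφ.almost_disjoint hi)
  have hint : ∀ z, IntegrableOn φ (R z) := fun z =>
    ((p z.1).integrableOn_eval (k z.1).isCompact_closedInterior (hRk z)).congr_fun_ae
      (hφ.ae_eq z.1 (hRk z))
  calc jointCDF μ (fun ω => N.eval (X ω)) y = ∫ x in {x | N.eval x ≤ y}, φ x :=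
        hX.measureReal_preimage hM
    _ = ∫ x in {x | N.eval x ≤ y} ∩ Set.Icc a b, φ x := by
        refine (setIntegral_eq_of_subset_of_forall_sdiff_eq_zero hM Set.inter_subset_left
          fun x hx => hφ.support x fun h => hx.2 ⟨hx.1, h⟩)
    _ = ∑ z, ∫ x in R z, φ x := by
        rw [hMR, integral_iUnion_ae (fun z => (hRm z).nullMeasurableSet) hdisj
          (integrableOn_finite_iUnion.2 hint), tsum_fintype]
    _ = ∑ z, ∫ x in R z, MvPolynomial.eval x (p z.1) :=
        Finset.sum_congr rfl fun z _ => (integral_congr_ae (hφ.ae_eq z.1 (hRk z))).symm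
    _ = _ := by rw [Fintype.sum_prod_type]

/-- No case distinction on the dimension is needed: if `A` is lower-dimensional, all these integrals
vanish. -/
theorem IsTriangulation.integral_eq_sum {n : ℕ} {A : Set (Fin n → ℝ)} {S : ℕ}
    {T : Fin S → Affine.Simplex ℝ (Fin n → ℝ) (affineDim A)} (hT : IsTriangulation A T)
    (p : MvPolynomial (Fin n) ℝ) :
    ∫ x in A, MvPolynomial.eval x p = ∑ s, ∫ x in (T s).closedInterior, MvPolynomial.eval x p := by
  rw [← tsum_fintype (L := .unconditional _), ← integral_iUnion_ae
    (fun s => (T s).isClosed_closedInterior.measurableSet.nullMeasurableSet)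
    hT.almost_disjoint (integrableOn_finite_iUnion.2 fun s =>
      p.integrableOn_eval (T s).isCompact_closedInterior le_rfl), hT.union]

/-! ### Bisecting simplices -/

theorem affineIndependent_iff_sum_smul {ι E : Type*} [Fintype ι] [AddCommGroup E] [Module ℝ E]
    {v : ι → E} : AffineIndependent ℝ v ↔
      ∀ w : ι → ℝ, ∑ i, w i = 0 → ∑ i, w i • v i = 0 → ∀ i, w i = 0 := by
  rw [affineIndependent_iff_of_fintype]
  refine forall₂_congr fun w hw => ?_
  rw [Finset.weightedVSub_eq_linear_combination _ hw]

theorem sum_smul_update {ι E : Type*} [Fintype ι] [DecidableEq ι] [AddCommGroup E] [Module ℝ E]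
    (w : ι → ℝ) (v : ι → E) (i : ι) (z : E) :
    ∑ k, w k • Function.update v i z k = ∑ k, w k • v k + w i • (z - v i) := by
  have h : ∀ k, w k • Function.update v i z k =
      w k • v k + if k = i then w i • (z - v i) else 0 := by
    intro k
    by_cases hk : k = i
    · subst hk; simp [← smul_add]
    · simp [hk]
  simp [h, Finset.sum_add_distrib]

theorem sum_add_single_sub_single_smul {ι E : Type*} [Fintype ι] [DecidableEq ι]
    [AddCommGroup E] [Module ℝ E] (w : ι → ℝ) (v : ι → E) (i j : ι) (a : ℝ) :
    ∑ k, (w + Pi.single i a - Pi.single j a : ι → ℝ) k • v k =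
      ∑ k, w k • v k + a • (v i - v j) := by
  simp [add_smul, sub_smul, Finset.sum_add_distrib, Finset.sum_sub_distrib, Pi.single_apply,
    smul_sub, add_sub_assoc]

/-- An affine relation `w` among the moved points becomes one among the original points when the
weight `t * w i` is shifted from `i` to `j`. The coefficient left at `i` is `(1 - t) * w i`, and `t
≠ 1`. -/
theorem AffineIndependent.update_lineMap {ι E : Type*} [Fintype ι] [DecidableEq ι]
    [AddCommGroup E] [Module ℝ E] {v : ι → E} (hv : AffineIndependent ℝ v) {i j : ι}
    (hij : i ≠ j) {t : ℝ} (ht : t ≠ 1) :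
    AffineIndependent ℝ (Function.update v i (AffineMap.lineMap (v i) (v j) t)) := by
  rw [affineIndependent_iff_sum_smul] at hv ⊢
  intro w hw hsum
  have hu := hv (w + Pi.single j (t * w i) - Pi.single i (t * w i))
    (by simp [Finset.sum_add_distrib, Finset.sum_sub_distrib, hw])
    (by
      rw [sum_add_single_sub_single_smul, ← hsum, sum_smul_update, AffineMap.lineMap_apply]
      simp [smul_smul, mul_comm])
  have hi : w i = 0 := by
    have := hu i
    simp only [Pi.sub_apply, Pi.add_apply, Pi.single_eq_same, Pi.single_eq_of_ne hij] at this
    have h2 : (1 - t) * w i = 0 := by linarith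
    exact (mul_eq_zero.1 h2).resolve_left (sub_ne_zero.2 ht.symm)
  intro k
  simpa [hi] using hu k

namespace Affine.Simplex

theorem mem_closedInterior_iff {n d : ℕ} (T : Affine.Simplex ℝ (Fin n → ℝ) d)
    {x : Fin n → ℝ} : x ∈ T.closedInterior ↔
      ∃ w : Fin (d + 1) → ℝ, (∀ k, 0 ≤ w k) ∧ ∑ k, w k = 1 ∧ ∑ k, w k • T.points k = x := by
  rw [← T.convexHull_eq_closedInterior]
  constructor
  · intro hx
    rw [convexHull_range_eq_exists_affineCombination] at hx
    obtain ⟨s, w, h0, h1, rfl⟩ := hx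
    refine ⟨(s : Set (Fin (d + 1))).indicator w, fun k => Set.indicator_apply_nonneg (h0 k), ?_, ?_⟩
    · rw [← h1]
      simp [Set.indicator_apply, Finset.sum_ite_mem]
    · rw [s.affineCombination_eq_linear_combination _ _ h1]
      simp [Set.indicator_apply, ite_smul, Finset.sum_ite_mem]
  · rintro ⟨w, h0, h1, rfl⟩
    exact (convex_convexHull ℝ _).sum_mem (fun k _ => h0 k) h1
      fun k _ => subset_convexHull ℝ _ ⟨k, rfl⟩

theorem nonneg_of_points {n d : ℕ} (T : Affine.Simplex ℝ (Fin n → ℝ) d)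
    (f : (Fin n → ℝ) →ᵃ[ℝ] ℝ) (h : ∀ k, 0 ≤ f (T.points k)) {x : Fin n → ℝ}
    (hx : x ∈ T.closedInterior) : 0 ≤ f x := by
  rw [← T.convexHull_eq_closedInterior] at hx
  refine convexHull_min ?_ ((convex_Ici (0 : ℝ)).affine_preimage f) hx
  rintro _ ⟨k, rfl⟩
  exact h k

/-- The simplex obtained by moving the `i`-th vertex along the edge to the `j`-th vertex. -/
noncomputable def slide {n d : ℕ} (T : Affine.Simplex ℝ (Fin n → ℝ) d) {i j : Fin (d + 1)}
    (hij : i ≠ j) {t : ℝ} (ht : t ≠ 1) : Affine.Simplex ℝ (Fin n → ℝ) d where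
  points := Function.update T.points i (AffineMap.lineMap (T.points i) (T.points j) t)
  independent := T.independent.update_lineMap hij ht

theorem slide_subset {n d : ℕ} (T : Affine.Simplex ℝ (Fin n → ℝ) d) {i j : Fin (d + 1)}
    (hij : i ≠ j) {t : ℝ} (h0 : 0 ≤ t) (h1 : t < 1) :
    (T.slide hij h1.ne).closedInterior ⊆ T.closedInterior := by
  rw [← convexHull_eq_closedInterior]
  refine convexHull_min ?_ T.convex_closedInterior
  rintro _ ⟨k, rfl⟩
  have hT : ∀ k, T.points k ∈ T.closedInterior := T.point_mem_closedInterior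
  by_cases hk : k = i
  · subst hk
    simp only [slide, Function.update_self]
    exact T.convex_closedInterior.lineMap_mem (hT _) (hT _) ⟨h0, h1.le⟩
  · simpa [slide, hk] using hT k

theorem mem_slide {n d : ℕ} (T : Affine.Simplex ℝ (Fin n → ℝ) d) {i j : Fin (d + 1)}
    (hij : i ≠ j) {t : ℝ} (h0 : 0 ≤ t) (h1 : t < 1) {w : Fin (d + 1) → ℝ}
    (hw : ∀ k, 0 ≤ w k) (hw1 : ∑ k, w k = 1) (h : t * w i ≤ (1 - t) * w j) :
    ∑ k, w k • T.points k ∈ (T.slide hij h1.ne).closedInterior := by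
  have ht : 0 < 1 - t := sub_pos.2 h1
  -- In the new barycentric coordinates, `i` has weight `w i / (1 - t)`, an increase of `a` taken
  -- from `j`. The hypothesis `h` says exactly that the weight left at `j` is nonnegative.
  set a := t / (1 - t) * w i with ha
  have hai : w i + a = w i / (1 - t) := by rw [ha]; field_simp; ring
  rw [mem_closedInterior_iff]
  refine ⟨w + Pi.single i a - Pi.single j a, fun k => ?_, ?_, ?_⟩
  · have ha0 : 0 ≤ a := mul_nonneg (div_nonneg h0 ht.le) (hw i)
    by_cases hk : k = j
    · subst hk
      simp only [Pi.sub_apply, Pi.add_apply, Pi.single_eq_same, Pi.single_eq_of_ne hij.symm]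
      have : a ≤ w k := by
        rw [ha, div_mul_eq_mul_div, div_le_iff₀ ht]; linarith
      linarith
    · have : 0 ≤ (Pi.single i a : Fin (d + 1) → ℝ) k := by
        by_cases hki : k = i
        · subst hki; simpa using ha0
        · simp [hki]
      simp only [Pi.sub_apply, Pi.add_apply, Pi.single_eq_of_ne hk]
      linarith [hw k]
  · simp [Finset.sum_add_distrib, Finset.sum_sub_distrib, hw1]
  · simp only [slide]
    rw [sum_smul_update, sum_add_single_sub_single_smul, AffineMap.lineMap_apply]
    simp only [Pi.sub_apply, Pi.add_apply, Pi.single_eq_same, Pi.single_eq_of_ne hij, sub_zero,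
      vsub_eq_sub, vadd_eq_add, add_sub_cancel_right, smul_smul, hai, add_assoc]
    rw [add_eq_left, ← neg_sub (T.points i), smul_neg, ← sub_eq_add_neg, ← sub_smul]
    have : a - w i / (1 - t) * t = 0 := by rw [ha]; ring
    rw [this, zero_smul]

/-- Sliding `i` towards `j` by `t` and `j` towards `i` by `1 - t` puts the moved vertex at the same
point of the edge. The two slides are therefore the halves of a bisection, told apart by comparing
`t * w i` with `(1 - t) * w j`. -/
theorem subset_slide_union {n d : ℕ} (T : Affine.Simplex ℝ (Fin n → ℝ) d) {i j : Fin (d + 1)}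
    (hij : i ≠ j) {t : ℝ} (h0 : 0 < t) (h1 : t < 1) :
    T.closedInterior ⊆ (T.slide hij h1.ne).closedInterior ∪
      (T.slide hij.symm (sub_lt_self 1 h0).ne).closedInterior := by
  intro x hx
  obtain ⟨w, hw, hw1, rfl⟩ := T.mem_closedInterior_iff.1 hx
  rcases le_total (t * w i) ((1 - t) * w j) with h | h
  · exact Or.inl (T.mem_slide hij h0.le h1 hw hw1 h)
  · exact Or.inr (T.mem_slide hij.symm (by linarith) (sub_lt_self 1 h0) hw hw1 (by linarith))

/-- This functional cuts out the bisecting hyperplane: it vanishes at every vertex of the slid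
simplex except `j`, where it is `1 - t`. The other half gets the opposite sign. -/
theorem slide_nonneg {n : ℕ} (T : Affine.Simplex ℝ (Fin n → ℝ) n) {i j : Fin (n + 1)}
    (hij : i ≠ j) {t : ℝ} (h1 : t < 1) {x : Fin n → ℝ}
    (hx : x ∈ (T.slide hij h1.ne).closedInterior) :
    0 ≤ ((1 - t) • T.affineBasis.coord j - t • T.affineBasis.coord i) x := by
  have hc : ∀ k l, T.affineBasis.coord k (T.points l) = if k = l then 1 else 0 :=
    fun k l => T.affineBasis.coord_apply k l
  refine nonneg_of_points _ _ (fun k => ?_) hx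
  by_cases hk : k = i
  · subst hk
    have hz : (T.slide hij h1.ne).points k = AffineMap.lineMap (T.points k) (T.points j) t := by
      simp [slide]
    rw [hz, AffineMap.apply_lineMap, AffineMap.lineMap_apply]
    simp only [AffineMap.coe_sub, AffineMap.coe_smul, Pi.sub_apply, Pi.smul_apply, hc, if_pos,
      hij, hij.symm, if_false, smul_eq_mul, vsub_eq_sub, vadd_eq_add]
    linarith
  · by_cases hkj : k = j
    · subst hkj
      simp [slide, hc, hij, hij.symm, h1.le]
    · simp [slide, hc, hk, Ne.symm hk, Ne.symm hkj]

theorem volume_slide_inter {n : ℕ} (T : Affine.Simplex ℝ (Fin n → ℝ) n) {i j : Fin (n + 1)}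
    (hij : i ≠ j) {t : ℝ} (h0 : 0 < t) (h1 : t < 1) :
    volume ((T.slide hij h1.ne).closedInterior ∩
      (T.slide hij.symm (sub_lt_self 1 h0).ne).closedInterior) = 0 := by
  refine measure_mono_null ?_ (volume_affine_zero
    ((1 - t) • T.affineBasis.coord j - t • T.affineBasis.coord i) fun h => ?_)
  · rintro x ⟨hx, hx'⟩
    have e1 := T.slide_nonneg hij h1 hx
    have e2 := T.slide_nonneg hij.symm (sub_lt_self 1 h0) hx'
    simp only [Set.mem_ofPred_eq, AffineMap.coe_sub, AffineMap.coe_smul, Pi.sub_apply,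
      Pi.smul_apply, smul_eq_mul, sub_sub_cancel] at e1 e2 ⊢
    linarith
  · have := congrArg (fun f => f (T.affineBasis j)) h
    simp [T.affineBasis.coord_apply_ne hij] at this
    linarith

end Affine.Simplex

/-! ### Dissections -/

/-- A finite family of full-dimensional simplices dissects `B`: it covers `B` exactly, without
overlaps of positive volume. -/
structure IsDissection {n : ℕ} (B : Set (Fin n → ℝ))
    (𝒯 : Finset (Affine.Simplex ℝ (Fin n → ℝ) n)) : Prop where
  union : ⋃ T ∈ 𝒯, T.closedInterior = B
  null : (𝒯 : Set (Affine.Simplex ℝ (Fin n → ℝ) n)).Pairwise fun T T' =>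
    volume (T.closedInterior ∩ T'.closedInterior) = 0

theorem IsDissection.singleton {n : ℕ} (T : Affine.Simplex ℝ (Fin n → ℝ) n) :
    IsDissection T.closedInterior {T} :=
  ⟨by simp, by simp⟩

theorem IsDissection.subset {n : ℕ} {B : Set (Fin n → ℝ)}
    {𝒯 : Finset (Affine.Simplex ℝ (Fin n → ℝ) n)} (h : IsDissection B 𝒯)
    {T : Affine.Simplex ℝ (Fin n → ℝ) n} (hT : T ∈ 𝒯) : T.closedInterior ⊆ B := by
  rw [← h.union]
  exact Set.subset_biUnion_of_mem (u := fun T : Affine.Simplex ℝ (Fin n → ℝ) n =>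
    T.closedInterior) hT

open Classical in
theorem IsDissection.biUnion {n : ℕ} {B : Set (Fin n → ℝ)}
    {𝒯 : Finset (Affine.Simplex ℝ (Fin n → ℝ) n)} (h : IsDissection B 𝒯)
    {D : Affine.Simplex ℝ (Fin n → ℝ) n → Finset (Affine.Simplex ℝ (Fin n → ℝ) n)}
    (hD : ∀ T ∈ 𝒯, IsDissection T.closedInterior (D T)) : IsDissection B (𝒯.biUnion D) := by
  constructor
  · rw [Finset.set_biUnion_biUnion, ← h.union]
    exact Set.iUnion₂_congr fun T hT => (hD T hT).union
  · intro T hT T' hT' hne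
    obtain ⟨U, hU, hTU⟩ := Finset.mem_biUnion.1 (Finset.mem_coe.1 hT)
    obtain ⟨U', hU', hTU'⟩ := Finset.mem_biUnion.1 (Finset.mem_coe.1 hT')
    by_cases hUU : U = U'
    · subst hUU
      exact (hD U hU).null hTU hTU' hne
    · exact measure_mono_null
        (Set.inter_subset_inter ((hD U hU).subset hTU) ((hD U' hU').subset hTU'))
        (h.null hU hU' hUU)

open Classical in
theorem Affine.Simplex.isDissection_slide {n : ℕ} (T : Affine.Simplex ℝ (Fin n → ℝ) n)
    {i j : Fin (n + 1)} (hij : i ≠ j) {t : ℝ} (h0 : 0 < t) (h1 : t < 1) :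
    IsDissection T.closedInterior
      {T.slide hij h1.ne, T.slide hij.symm (sub_lt_self 1 h0).ne} := by
  constructor
  · simp only [Finset.mem_insert, Finset.mem_singleton, Set.iUnion_iUnion_eq_or_left,
      Set.iUnion_iUnion_eq_left]
    exact Set.Subset.antisymm (Set.union_subset (T.slide_subset hij h0.le h1)
      (T.slide_subset hij.symm (by linarith) (sub_lt_self 1 h0)))
      (T.subset_slide_union hij h0 h1)
  · rw [Finset.coe_pair, Set.pairwise_pair]
    exact fun _ => ⟨T.volume_slide_inter hij h0 h1,
      by rw [Set.inter_comm]; exact T.volume_slide_inter hij h0 h1⟩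

/-- The affine functional `f` does not change sign on the set `B`. -/
def IsSemidefiniteOn {n : ℕ} (f : (Fin n → ℝ) →ᵃ[ℝ] ℝ) (B : Set (Fin n → ℝ)) : Prop :=
  (∀ x ∈ B, f x ≤ 0) ∨ ∀ x ∈ B, 0 ≤ f x

theorem IsSemidefiniteOn.mono {n : ℕ} {f : (Fin n → ℝ) →ᵃ[ℝ] ℝ} {B B' : Set (Fin n → ℝ)}
    (h : IsSemidefiniteOn f B) (hB : B' ⊆ B) : IsSemidefiniteOn f B' :=
  h.imp (fun h x hx => h x (hB hx)) fun h x hx => h x (hB hx)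

/-- The termination measure for the bisection: a vertex off the hyperplane `f = 0` is replaced by
one on it. -/
theorem Affine.Simplex.card_slide_lt {n : ℕ} (T : Affine.Simplex ℝ (Fin n → ℝ) n)
    (f : (Fin n → ℝ) →ᵃ[ℝ] ℝ) {i j : Fin (n + 1)} (hij : i ≠ j) {t : ℝ} (ht : t ≠ 1)
    (hi : f (T.points i) ≠ 0) (hz : f (AffineMap.lineMap (T.points i) (T.points j) t) = 0) :
    (Finset.univ.filter fun k => f ((T.slide hij ht).points k) ≠ 0).card <
      (Finset.univ.filter fun k => f (T.points k) ≠ 0).card := by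
  refine Finset.card_lt_card (Finset.ssubset_iff_of_subset (fun k hk => ?_) |>.2
    ⟨i, Finset.mem_filter.2 ⟨Finset.mem_univ _, hi⟩, fun h => (Finset.mem_filter.1 h).2 ?_⟩)
  · refine Finset.mem_filter.2 ⟨Finset.mem_univ _, ?_⟩
    by_cases hki : k = i
    · rwa [hki]
    · simpa only [slide, Function.update_of_ne hki] using (Finset.mem_filter.1 hk).2
  · simpa only [slide, Function.update_self] using hz

open Classical in
-- If `f` has one weak sign at all vertices, it keeps it on the simplex. Otherwise some edge has
-- ends of strictly opposite signs; bisect it at the zero of `f` and recurse.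
theorem Affine.Simplex.exists_isDissection_semidefinite {n : ℕ} (f : (Fin n → ℝ) →ᵃ[ℝ] ℝ)
    (T : Affine.Simplex ℝ (Fin n → ℝ) n) :
    ∃ 𝒯, IsDissection T.closedInterior 𝒯 ∧ ∀ U ∈ 𝒯, IsSemidefiniteOn f U.closedInterior := by
  induction hm : (Finset.univ.filter fun k => f (T.points k) ≠ 0).card using
    Nat.strong_induction_on generalizing T with
  | _ m ih =>
    subst hm
    by_cases hpos : ∀ k, 0 ≤ f (T.points k)
    · exact ⟨{T}, .singleton T, fun U hU => Finset.mem_singleton.1 hU ▸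
        Or.inr fun x hx => T.nonneg_of_points f hpos hx⟩
    by_cases hneg : ∀ k, f (T.points k) ≤ 0
    · refine ⟨{T}, .singleton T, ?_⟩
      have : ∀ x ∈ T.closedInterior, f x ≤ 0 := fun x hx => by
        simpa using T.nonneg_of_points (-f) (by simpa using hneg) hx
      exact fun U hU => Finset.mem_singleton.1 hU ▸ Or.inl this
    push Not at hpos hneg
    obtain ⟨j, hj⟩ := hpos
    obtain ⟨i, hi⟩ := hneg
    have hij : i ≠ j := by rintro rfl; linarith
    have hd : 0 < f (T.points i) - f (T.points j) := by linarith
    set t := f (T.points i) / (f (T.points i) - f (T.points j)) with ht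
    have h0 : 0 < t := div_pos hi hd
    have h1 : t < 1 := by rw [ht, div_lt_one hd]; linarith
    have hz : f (AffineMap.lineMap (T.points i) (T.points j) t) = 0 := by
      rw [AffineMap.apply_lineMap, AffineMap.lineMap_apply, ht]
      simp only [vsub_eq_sub, smul_eq_mul, vadd_eq_add]
      field_simp
      ring
    have hz' : f (AffineMap.lineMap (T.points j) (T.points i) (1 - t)) = 0 := by
      rwa [AffineMap.lineMap_apply_one_sub]
    obtain ⟨D₁, hD₁, hs₁⟩ := ih _ (T.card_slide_lt f hij h1.ne hi.ne' hz) _ rfl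
    obtain ⟨D₂, hD₂, hs₂⟩ :=
      ih _ (T.card_slide_lt f hij.symm (sub_lt_self 1 h0).ne hj.ne hz') _ rfl
    have hex : ∀ U ∈ ({T.slide hij h1.ne, T.slide hij.symm (sub_lt_self 1 h0).ne} : Finset _),
        ∃ 𝒯, IsDissection U.closedInterior 𝒯 ∧
          ∀ U' ∈ 𝒯, IsSemidefiniteOn f U'.closedInterior := by
      intro U hU
      rcases Finset.mem_insert.1 hU with rfl | hU
      · exact ⟨D₁, hD₁, hs₁⟩
      · rw [Finset.mem_singleton.1 hU]
        exact ⟨D₂, hD₂, hs₂⟩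
    choose! D hD hs using hex
    refine ⟨_, (T.isDissection_slide hij h0 h1).biUnion hD, fun U hU => ?_⟩
    obtain ⟨U', hU', hUU'⟩ := Finset.mem_biUnion.1 hU
    exact hs U' hU' U hUU'

open Classical in
theorem Affine.Simplex.exists_isDissection_forall_semidefinite {n : ℕ} {ι : Type*}
    (f : ι → (Fin n → ℝ) →ᵃ[ℝ] ℝ) (T : Affine.Simplex ℝ (Fin n → ℝ) n) (s : Finset ι) :
    ∃ 𝒯, IsDissection T.closedInterior 𝒯 ∧
      ∀ U ∈ 𝒯, ∀ i ∈ s, IsSemidefiniteOn (f i) U.closedInterior := by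
  induction s using Finset.induction_on with
  | empty => exact ⟨{T}, .singleton T, by simp⟩
  | insert i s _ ih =>
    obtain ⟨𝒯, h𝒯, hs⟩ := ih
    choose D hD hD' using fun U : Affine.Simplex ℝ (Fin n → ℝ) n =>
      U.exists_isDissection_semidefinite (f i)
    refine ⟨_, h𝒯.biUnion fun U _ => hD U, fun U hU i' hi' => ?_⟩
    obtain ⟨U', hU', hUU'⟩ := Finset.mem_biUnion.1 hU
    rcases Finset.mem_insert.1 hi' with rfl | hi'
    · exact hD' U' U hUU'
    · exact (hs U' hU' i' hi').mono ((hD U').subset hUU')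

theorem Bornology.IsBounded.exists_simplex_superset {n : ℕ} {A : Set (Fin n → ℝ)}
    (hA : Bornology.IsBounded A) :
    ∃ T : Affine.Simplex ℝ (Fin n → ℝ) n, A ⊆ T.closedInterior := by
  obtain ⟨b, hb, -⟩ :=
    exists_mem_interior_convexHull_affineBasis (Filter.univ_mem : Set.univ ∈ nhds (0 : Fin n → ℝ))
  have hcard : Module.finrank ℝ (Fin n → ℝ) + 1 = n + 1 := by simp
  let T₀ : Affine.Simplex ℝ (Fin n → ℝ) n :=
    ⟨b ∘ finCongr hcard.symm, b.ind.comp_embedding (finCongr hcard.symm).toEmbedding⟩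
  have hT₀ : T₀.closedInterior = convexHull ℝ (Set.range b) := by
    rw [← T₀.convexHull_eq_closedInterior, (finCongr hcard.symm).surjective.range_comp]
  rw [← hT₀, mem_interior_iff_mem_nhds, Metric.mem_nhds_iff] at hb
  obtain ⟨ε, hε, hball⟩ := hb
  obtain ⟨R, hR0, hR⟩ := hA.exists_pos_norm_lt
  -- `T₀` contains the `ε`-ball about `0`, and `A` lies in the `R`-ball, so scaling by `R / ε`
  -- suffices.
  have hc : 0 < R / ε := div_pos hR0 hε
  have hinj : Function.Injective (AffineMap.homothety (0 : Fin n → ℝ) (R / ε)) := by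
    intro x y hxy
    simpa [AffineMap.homothety_apply, hR0.ne', hε.ne'] using hxy
  refine ⟨T₀.map _ hinj, fun x hx => ?_⟩
  rw [Affine.Simplex.closedInterior_map]
  refine ⟨(R / ε)⁻¹ • x, hball ?_, ?_⟩
  · rw [mem_ball_zero_iff, norm_smul, Real.norm_of_nonneg (by positivity), inv_div,
      div_mul_eq_mul_div, div_lt_iff₀ hR0]
    exact mul_lt_mul_of_pos_left (hR x hx) hε
  · simp [AffineMap.homothety_apply, smul_smul, hR0.ne', hε.ne']

open Classical in
-- A piece not contained in `A` has a point where some `f i > 0`, hence `f i ≥ 0` on the whole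
-- piece, so it meets `A` only in the null set `f i = 0`. The pieces inside `A` thus cover `interior
-- A` up to a null set. What they miss there is open, hence empty, and convexity makes `interior A`
-- dense in `A`.
theorem IsHPolytope.exists_isDissection {n : ℕ} {A : Set (Fin n → ℝ)} (hA : IsHPolytope A)
    (hb : Bornology.IsBounded A) (hi : (interior A).Nonempty) : ∃ 𝒯, IsDissection A 𝒯 := by
  obtain ⟨h, f, hf⟩ := hA.exists_affine
  obtain ⟨T, hT⟩ := hb.exists_simplex_superset
  obtain ⟨𝒯, h𝒯, hs⟩ := T.exists_isDissection_forall_semidefinite f Finset.univ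
  refine ⟨𝒯.filter fun U => U.closedInterior ⊆ A, ?_, fun U hU U' hU' => h𝒯.null
    (Finset.mem_filter.1 hU).1 (Finset.mem_filter.1 hU').1⟩
  set W := ⋃ U ∈ 𝒯.filter fun U => U.closedInterior ⊆ A, U.closedInterior with hW
  have hWc : IsClosed W := isClosed_biUnion_finset fun U _ => U.isClosed_closedInterior
  refine Set.Subset.antisymm (Set.iUnion₂_subset fun U hU => (Finset.mem_filter.1 hU).2) ?_
  have hnull : ∀ U ∈ 𝒯, ¬ U.closedInterior ⊆ A → volume (U.closedInterior ∩ A) = 0 := by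
    intro U hU hUA
    obtain ⟨x, hxU, hxA⟩ := Set.not_subset.1 hUA
    rw [hf] at hxA
    simp only [Set.mem_iInter, Set.mem_ofPred_eq, not_forall, not_le] at hxA
    obtain ⟨i, hx⟩ := hxA
    have hpos : ∀ z ∈ U.closedInterior, 0 ≤ f i z :=
      (hs U hU i (Finset.mem_univ i)).resolve_left fun h => (h x hxU).not_gt hx
    refine measure_mono_null ?_ (volume_affine_zero (f i) fun h0 => ?_)
    · rintro z ⟨hzU, hzA⟩
      rw [hf] at hzA
      exact le_antisymm (Set.mem_iInter.1 hzA i) (hpos z hzU)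
    · rw [h0] at hx
      simp at hx
  have hint : interior A ⊆ W := by
    rw [← Set.sdiff_eq_empty, ← (isOpen_interior.sdiff hWc).measure_eq_zero_iff (μ := volume)]
    refine measure_mono_null (t := ⋃ U ∈ 𝒯.filter fun U => ¬ U.closedInterior ⊆ A,
      U.closedInterior ∩ A) ?_ ?_
    · rintro x ⟨hx, hxW⟩
      have hxA := interior_subset hx
      have hxT := hT hxA
      rw [← h𝒯.union] at hxT
      obtain ⟨U, hU, hxU⟩ := Set.mem_iUnion₂.1 hxT
      refine Set.mem_iUnion₂.2 ⟨U, Finset.mem_filter.2 ⟨hU, fun hUA => hxW ?_⟩, hxU, hxA⟩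
      exact Set.mem_iUnion₂.2 ⟨U, Finset.mem_filter.2 ⟨hU, hUA⟩, hxU⟩
    · refine (measure_biUnion_null_iff (Finset.countable_toSet _)).2 fun U hU => ?_
      obtain ⟨hU, hUA⟩ := Finset.mem_filter.1 (Finset.mem_coe.1 hU)
      exact hnull U hU hUA
  calc A ⊆ closure A := subset_closure
    _ = closure (interior A) :=
      (hA.convex.closure_interior_eq_closure_of_nonempty_interior hi).symm
    _ ⊆ W := closure_minimal hint hWc

/-! ### Triangulating bounded polytopes of any dimension -/

theorem exists_affineMap_range_eq_affineSpan {n : ℕ} {A : Set (Fin n → ℝ)} (hA : A.Nonempty) :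
    ∃ g : (Fin (affineDim A) → ℝ) →ᵃ[ℝ] (Fin n → ℝ), Topology.IsClosedEmbedding g ∧
      Set.range g = affineSpan ℝ A := by
  obtain ⟨a, ha⟩ := hA
  let e : (Fin (affineDim A) → ℝ) ≃ₗ[ℝ] vectorSpan ℝ A :=
    LinearEquiv.ofFinrankEq _ _ (Module.finrank_fin_fun ℝ)
  let L : (Fin (affineDim A) → ℝ) →ₗ[ℝ] (Fin n → ℝ) := (vectorSpan ℝ A).subtype ∘ₗ e.toLinearMap
  have hL : Topology.IsClosedEmbedding L := LinearMap.isClosedEmbedding_of_injective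
    (LinearMap.ker_eq_bot.2 (Subtype.val_injective.comp e.injective))
  refine ⟨L.toAffineMap + AffineMap.const ℝ _ a,
    (Homeomorph.addRight a).isClosedEmbedding.comp hL, ?_⟩
  ext x
  have hx : x ∈ affineSpan ℝ A ↔ x - a ∈ vectorSpan ℝ A := by
    rw [← direction_affineSpan, ← vsub_eq_sub,
      AffineSubspace.vsub_right_mem_direction_iff_mem (subset_affineSpan ℝ A ha)]
  rw [SetLike.mem_coe, hx]
  constructor
  · rintro ⟨z, rfl⟩
    simp [L]
  · intro h
    exact ⟨e.symm ⟨x - a, h⟩, by simp [L]⟩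

/-- `g` is continuous into the affine span of the image, so a relatively open subset of `g '' B` has
an open preimage, contained in `B` by injectivity. -/
theorem intrinsicInterior_image_subset {d n : ℕ} {g : (Fin d → ℝ) →ᵃ[ℝ] (Fin n → ℝ)}
    (hg : Function.Injective g) {B : Set (Fin d → ℝ)} (hB : affineSpan ℝ B = ⊤) :
    intrinsicInterior ℝ (g '' B) ⊆ g '' interior B := by
  have hspan : ∀ z, g z ∈ affineSpan ℝ (g '' B) := fun z => by
    rw [← AffineSubspace.map_span, hB]
    exact AffineSubspace.mem_map_of_mem g (AffineSubspace.mem_top ℝ _ z)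
  have hcont : Continuous fun z => (⟨g z, hspan z⟩ : affineSpan ℝ (g '' B)) :=
    g.continuous_of_finiteDimensional.subtype_mk _
  rintro _ ⟨⟨x, hxs⟩, hx, rfl⟩
  have hxB := interior_subset hx
  rw [Set.mem_preimage] at hxB
  obtain ⟨z, -, rfl⟩ := hxB
  refine ⟨z, mem_interior.2 ⟨_, ?_, isOpen_interior.preimage hcont, hx⟩, rfl⟩
  intro u hu
  obtain ⟨u', hu', h⟩ : g u ∈ g '' B :=
    (interior_subset hu : (⟨g u, hspan u⟩ : affineSpan ℝ (g '' B)) ∈ (_ ⁻¹' (g '' B) : Set _))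
  exact hg h ▸ hu'

theorem disjoint_interior_of_volume_inter {n : ℕ} {B C : Set (Fin n → ℝ)}
    (h : volume (B ∩ C) = 0) : Disjoint (interior B) (interior C) := by
  rw [Set.disjoint_iff_inter_eq_empty, ← interior_inter,
    ← isOpen_interior.measure_eq_zero_iff (μ := volume)]
  exact measure_mono_null interior_subset h

theorem Convex.volume_inter_of_disjoint_interior {n : ℕ} {B C : Set (Fin n → ℝ)}
    (hB : Convex ℝ B) (hC : Convex ℝ C) (h : Disjoint (interior B) (interior C)) :
    volume (B ∩ C) = 0 := by
  refine measure_mono_null (t := frontier (B ∩ C)) ?_ ((hB.inter hC).addHaar_frontier volume)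
  refine fun x hx => ⟨subset_closure hx, fun hxi => ?_⟩
  rw [interior_inter] at hxi
  exact Set.disjoint_iff.1 h hxi

theorem IsHPolytope.exists_simplices_of_range_eq_affineSpan {d n : ℕ} {A : Set (Fin n → ℝ)}
    (hA : IsHPolytope A) (hb : Bornology.IsBounded A) {g : (Fin d → ℝ) →ᵃ[ℝ] (Fin n → ℝ)}
    (hg : Topology.IsClosedEmbedding g) (hrange : Set.range g = affineSpan ℝ A) :
    ∃ (S : ℕ) (T : Fin S → Affine.Simplex ℝ (Fin n → ℝ) d),
      ⋃ s, (T s).closedInterior = A ∧ Pairwise fun s s' =>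
        Disjoint (intrinsicInterior ℝ (T s).closedInterior)
          (intrinsicInterior ℝ (T s').closedInterior) := by
  have himage : g '' (g ⁻¹' A) = A := by
    rw [Set.image_preimage_eq_inter_range, hrange, Set.inter_eq_left]
    exact subset_affineSpan ℝ A
  have hpoly : IsHPolytope (g ⁻¹' A) := by
    obtain ⟨h, f, hf⟩ := hA.exists_affine
    rw [hf, Set.preimage_iInter]
    exact .of_affine fun i => (f i).comp g
  have hbdd : Bornology.IsBounded (g ⁻¹' A) :=
    (hg.isCompact_preimage (Metric.isCompact_of_isClosed_isBounded hA.isClosed hb)).isBounded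
  -- A convex set has nonempty interior once it affinely spans; here `g` identifies the coordinate
  -- space with the span of `A`.
  have hint : (interior (g ⁻¹' A)).Nonempty := by
    rw [hpoly.convex.interior_nonempty_iff_affineSpan_eq_top, eq_top_iff]
    intro z _
    have hz : g z ∈ (affineSpan ℝ A : Set (Fin n → ℝ)) := hrange ▸ Set.mem_range_self z
    rw [← himage, ← AffineSubspace.map_span] at hz
    obtain ⟨z', hz', h⟩ := hz
    exact hg.injective h ▸ hz'
  obtain ⟨𝒯, h𝒯⟩ := hpoly.exists_isDissection hbdd hint
  let e := 𝒯.equivFin.symm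
  refine ⟨𝒯.card, fun s => (e s).1.map g hg.injective, ?_, fun s s' hss' => ?_⟩
  · simp only [Affine.Simplex.closedInterior_map]
    rw [e.surjective.iUnion_comp fun U : 𝒯 => g '' U.1.closedInterior, ← Set.image_iUnion,
      Set.iUnion_subtype, h𝒯.union, himage]
  · have hspan : ∀ U : Affine.Simplex ℝ (Fin d → ℝ) d, affineSpan ℝ U.closedInterior = ⊤ :=
      fun U => U.affineSpan_closedInterior.trans U.affineBasis.tot
    have hne : (e s).1 ≠ (e s').1 := fun h => hss' (e.injective (Subtype.ext h))
    simp only [Affine.Simplex.closedInterior_map]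
    exact ((Set.disjoint_image_iff hg.injective).2
      (disjoint_interior_of_volume_inter (h𝒯.null (e s).2 (e s').2 hne))).mono
      (intrinsicInterior_image_subset hg.injective (hspan _))
      (intrinsicInterior_image_subset hg.injective (hspan _))

theorem IsHPolytope.exists_isTriangulation {n : ℕ} {A : Set (Fin n → ℝ)} (hA : IsHPolytope A)
    (hb : Bornology.IsBounded A) :
    ∃ (S : ℕ) (T : Fin S → Affine.Simplex ℝ (Fin n → ℝ) (affineDim A)), IsTriangulation A T := by
  rcases A.eq_empty_or_nonempty with rfl | hne
  · exact ⟨0, Fin.elim0, by simp, fun s => s.elim0, fun s => s.elim0⟩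
  obtain ⟨g, hg, hrange⟩ := exists_affineMap_range_eq_affineSpan hne
  obtain ⟨S, T, hT, hd⟩ := hA.exists_simplices_of_range_eq_affineSpan hb hg hrange
  -- Interiors lie in relative interiors, so they are disjoint too, and convex sets with disjoint
  -- interiors overlap only in the null frontier of their intersection.
  exact ⟨S, T, hT, fun s s' hss' => Convex.volume_inter_of_disjoint_interior
    (T s).convex_closedInterior (T s').convex_closedInterior ((hd hss').mono
      interior_subset_intrinsicInterior interior_subset_intrinsicInterior), hd⟩

theorem mainTheorem1 {n₀ nL : ℕ} (N : ReLUNetwork n₀ nL)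
    {Ω : Type*} [MeasurableSpace Ω] (μ : Measure Ω) [IsProbabilityMeasure μ]
    (X : Ω → Fin n₀ → ℝ) (φ : (Fin n₀ → ℝ) → ℝ) (hX : IsPDFOf φ X μ)
    (a b : Fin n₀ → ℝ) {qφ : ℕ} (k : Fin qφ → Affine.Simplex ℝ (Fin n₀ → ℝ) n₀)
    (p : Fin qφ → MvPolynomial (Fin n₀) ℝ) (hφ : IsPiecewisePolynomialOnBox φ a b k p) :
    -- a splitting of the input space exists
    (∃ (qY : ℕ) (P : Fin qY → Set (Fin n₀ → ℝ)) (V : Fin qY → Matrix (Fin nL) (Fin n₀) ℝ)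
      (c : Fin qY → Fin nL → ℝ), N.IsSplitBy P V c) ∧
    -- and every splitting computes the output cdf
    ∀ (qY : ℕ) (P : Fin qY → Set (Fin n₀ → ℝ)) (V : Fin qY → Matrix (Fin nL) (Fin n₀) ℝ)
      (c : Fin qY → Fin nL → ℝ), N.IsSplitBy P V c → ∀ y : Fin nL → ℝ,
      jointCDF μ (fun ω => N.eval (X ω)) y =
        ∑ i, ∑ j, (∫ x in reducedPolytope (P j) (k i) (V j) (c j) y, MvPolynomial.eval x (p i)) ∧
      (∀ j, {x | c j + V j *ᵥ x ≤ y} = ⋂ t, {x | (c j + V j *ᵥ x) t ≤ y t}) ∧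
      (∀ i j, IsHPolytope (reducedPolytope (P j) (k i) (V j) (c j) y) ∧
        ∃ (S : ℕ) (T : Fin S → Affine.Simplex ℝ (Fin n₀ → ℝ)
            (affineDim (reducedPolytope (P j) (k i) (V j) (c j) y))),
          IsTriangulation (reducedPolytope (P j) (k i) (V j) (c j) y) T) ∧
      ∀ (S : Fin qφ → Fin qY → ℕ)
        (T : ∀ i j, Fin (S i j) → Affine.Simplex ℝ (Fin n₀ → ℝ)
          (affineDim (reducedPolytope (P j) (k i) (V j) (c j) y))),
        (∀ i j, IsTriangulation (reducedPolytope (P j) (k i) (V j) (c j) y) (T i j)) →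
        jointCDF μ (fun ω => N.eval (X ω)) y =
          ∑ i, ∑ j, ∑ s, (∫ x in (T i j s).closedInterior, MvPolynomial.eval x (p i)) := by

  refine ⟨N.exists_isSplitBy, fun qY P V c hP y => ?_⟩
  have hcdf := jointCDF_eq_sum_reducedPolytope hX hφ hP y
  refine ⟨hcdf, fun j => ?_, fun i j => ?_, fun S T hT => ?_⟩
  · ext x
    simp [Pi.le_def]
  · have hR := isHPolytope_reducedPolytope (hP.polytope j) (k i) (V j) (c j) y
    exact ⟨hR, hR.exists_isTriangulation
      ((k i).isCompact_closedInterior.isBounded.subset fun x hx => hx.1.2)⟩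
  · rw [hcdf]
    exact Finset.sum_congr rfl fun i _ => Finset.sum_congr rfl fun j _ =>
      (hT i j).integral_eq_sum (p i)
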